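/- Let $p$ be a prime, let $X=\{x_1,\dots,x_p\}$, and let $T$ be the $p$-adic rooted tree, whose vertices are the finite words over $X$, the root being the empty word and each word $u$ being joined to the words $ux$ with $x\in X$. Let $\operatorname{Aut}(T)$ be its automorphism group, acting on the right, and let $G=\langle a,b\rangle\le\operatorname{Aut}(T)$ be the $p$-Basilica group, where $a$ and $b$ are the automorphisms that fix the root and satisfy, for all words $v$ over $X$, $$(x_iv)^a=x_iv,\qquad (x_iv)^b=x_{i+1}v\quad(1\le i<p),\qquad (x_pv)^a=x_p\,v^{b},\qquad (x_pv)^b=x_1\,v^{a}.$$ Then the group $\operatorname{Aut}(G)$ of all abstract automorphisms of $G$ equals the normaliser $N_{\operatorname{Aut}(T)}(G)$ of $G$ in $\operatorname{Aut}(T)$; that is, the homomorphism $N_{\operatorname{Aut}(T)}(G)\to\operatorname{Aut}(G)$ given by the conjugation action on $G$ is bijective. -/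

import Mathlib

namespace PBasilica

/-- The `p`-adic rooted tree as a graph: the vertices are the words over the alphabet
`X = {x_1, …, x_p}` (here `Fin p`, with `x_i` the element of value `i - 1`), the root is the
empty word, and two vertices are adjacent iff one is obtained from the other by appending
one letter. -/
def tree (p : ℕ) : SimpleGraph (List (Fin p)) where
  Adj u v := ∃ x : Fin p, v = u ++ [x] ∨ u = v ++ [x]
  symm := ⟨fun _ _ ⟨x, h⟩ => ⟨x, h.symm⟩⟩
  loopless := ⟨fun u ⟨x, h⟩ => by rcases h with h | h <;> simp at h⟩

/-- The group `Aut(T)` of graph automorphisms of the `p`-adic tree, under composition. -/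
abbrev TreeAut (p : ℕ) : Type := tree p ≃g tree p

/-- `x` is the last letter `x_p` of the alphabet. -/
def IsLast {p : ℕ} (x : Fin p) : Prop := (x : ℕ) + 1 = p

instance {p : ℕ} (x : Fin p) : Decidable (IsLast x) :=
  inferInstanceAs (Decidable ((x : ℕ) + 1 = p))

mutual
/-- The action of `a`: trivial root label, section `b` at `x_p`, and trivial section at the
other letters. -/
def aFun {p : ℕ} : List (Fin p) → List (Fin p)
  | [] => []
  | x :: v => x :: (if IsLast x then bFun v else v)
/-- The action of `b`: root label the `p`-cycle `σ = (x_1 x_2 ⋯ x_p)`, section `a` at `x_p`,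
and trivial section at the other letters. -/
def bFun {p : ℕ} : List (Fin p) → List (Fin p)
  | [] => []
  | x :: v => finRotate p x :: (if IsLast x then aFun v else v)
end

mutual
/-- The inverse of `aFun`. -/
def aInv {p : ℕ} : List (Fin p) → List (Fin p)
  | [] => []
  | x :: v => x :: (if IsLast x then bInv v else v)
/-- The inverse of `bFun`. -/
def bInv {p : ℕ} : List (Fin p) → List (Fin p)
  | [] => []
  | y :: v => (finRotate p).symm y :: (if IsLast ((finRotate p).symm y) then aInv v else v)
end

theorem inv_fun {p : ℕ} (v : List (Fin p)) : aInv (aFun v) = v ∧ bInv (bFun v) = v := by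
  induction v with
  | nil => simp [aFun, bFun, aInv, bInv]
  | cons x v ih =>
    obtain ⟨h1, h2⟩ := ih
    by_cases h : IsLast x <;>
      simp [aFun, bFun, aInv, bInv, h, h1, h2, -finRotate_apply, -finRotate_symm_apply]

theorem fun_inv {p : ℕ} (v : List (Fin p)) : aFun (aInv v) = v ∧ bFun (bInv v) = v := by
  induction v with
  | nil => simp [aFun, bFun, aInv, bInv]
  | cons x v ih =>
    obtain ⟨h1, h2⟩ := ih
    constructor
    · by_cases h : IsLast x <;> simp [aFun, aInv, h, h2]
    · by_cases h : IsLast ((finRotate p).symm x) <;>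
        simp [bFun, bInv, h, h1, -finRotate_apply, -finRotate_symm_apply]

theorem fun_append {p : ℕ} (v : List (Fin p)) (x : Fin p) :
    (∃ y, aFun (v ++ [x]) = aFun v ++ [y]) ∧ (∃ y, bFun (v ++ [x]) = bFun v ++ [y]) := by
  induction v with
  | nil => simp [aFun, bFun]
  | cons z v ih =>
    obtain ⟨⟨y1, h1⟩, ⟨y2, h2⟩⟩ := ih
    by_cases h : IsLast z <;> simp [aFun, bFun, h, h1, h2]

theorem inv_append {p : ℕ} (v : List (Fin p)) (x : Fin p) :
    (∃ y, aInv (v ++ [x]) = aInv v ++ [y]) ∧ (∃ y, bInv (v ++ [x]) = bInv v ++ [y]) := by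
  induction v with
  | nil => simp [aInv, bInv]
  | cons z v ih =>
    obtain ⟨⟨y1, h1⟩, ⟨y2, h2⟩⟩ := ih
    constructor
    · by_cases h : IsLast z <;> simp [aInv, h, h2]
    · by_cases h : IsLast ((finRotate p).symm z) <;>
        simp [bInv, h, h1, -finRotate_apply, -finRotate_symm_apply]

theorem adj_of_append {p : ℕ} {f : List (Fin p) → List (Fin p)}
    (hf : ∀ v x, ∃ y, f (v ++ [x]) = f v ++ [y]) {u v : List (Fin p)}
    (h : (tree p).Adj u v) : (tree p).Adj (f u) (f v) := by
  obtain ⟨x, rfl | rfl⟩ := h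
  · obtain ⟨y, hy⟩ := hf u x
    exact ⟨y, Or.inl hy⟩
  · obtain ⟨y, hy⟩ := hf v x
    exact ⟨y, Or.inr hy⟩

/-- The automorphism `a` with `ψ(a) = (1, …, 1, b)`. -/
def a (p : ℕ) : TreeAut p where
  toFun := aFun
  invFun := aInv
  left_inv v := (inv_fun v).1
  right_inv v := (fun_inv v).1
  map_rel_iff' := by
    intro u v
    refine ⟨fun h => ?_, fun h => adj_of_append (fun w x => (fun_append w x).1) h⟩
    have h' := adj_of_append (fun w x => (inv_append w x).1) h
    simpa [(inv_fun _).1] using h'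

/-- The automorphism `b` with `ψ(b) = (1, …, 1, a) σ`. -/
def b (p : ℕ) : TreeAut p where
  toFun := bFun
  invFun := bInv
  left_inv v := (inv_fun v).2
  right_inv v := (fun_inv v).2
  map_rel_iff' := by
    intro u v
    refine ⟨fun h => ?_, fun h => adj_of_append (fun w x => (fun_append w x).2) h⟩
    have h' := adj_of_append (fun w x => (inv_append w x).2) h
    simpa [(inv_fun _).2] using h'

theorem a_cons {p : ℕ} (x : Fin p) (v : List (Fin p)) :
    a p (x :: v) = x :: (if IsLast x then b p v else v) := by
  change aFun (x :: v) = x :: (if IsLast x then bFun v else v)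
  rw [aFun]

theorem b_cons {p : ℕ} (x : Fin p) (v : List (Fin p)) :
    b p (x :: v) = finRotate p x :: (if IsLast x then a p v else v) := by
  change bFun (x :: v) = finRotate p x :: (if IsLast x then aFun v else v)
  rw [bFun]

/-- The `p`-Basilica group, the subgroup of `Aut(T)` generated by `a` and `b`. -/
def basilica (p : ℕ) : Subgroup (TreeAut p) := Subgroup.closure {a p, b p}

end PBasilica

open scoped commutatorElement

namespace PBasilica

/-! ### Automorphisms of the tree -/

-- The tree can be recovered from the abstract group $G$ through commutation in rigid stabilisers.
-- Let $\Gamma_0=G$ and $\Gamma_{n+1}=\Gamma_n^p[\Gamma_n,\Gamma_n]$. These subgroups are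
-- characteristic. Since $G$ acts on first letters through a cyclic group of order $p$, $\Gamma_n$
-- fixes level $n$ pointwise (`powerSeries_apply`), yet its sections at each vertex of level $n$
-- exhaust $G$ (`exists_powerSeries_hasSection`). Moreover $G$ is weakly branch over the normal
-- closure of $[a,b]$ (`exists_supportedOn`), so every nontrivial normal subgroup, in particular
-- $\Gamma_n$, meets every rigid stabiliser (`exists_mem_supportedOn`).
--
-- Let $x,y\ne1$ each be supported below some vertex of level $n$. If the vertices differ, $x$
-- commutes with all $\Gamma_n$-conjugates of $y$; if they agree, it does not
-- (`exists_powerSeries_not_commute_conj`). An automorphism $\alpha$ preserves $\Gamma_n$ and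
-- commutation, so it carries elements of $\Gamma_n$ supported below $u$ to elements supported below
-- a single vertex, `wordMap α u`. This map is a tree automorphism, and its equivariance says that
-- it induces $\alpha$ by conjugation. Injectivity holds because an automorphism moving $v$ commutes
-- with no nontrivial element supported below $v$.

theorem treeAut_nil {p : ℕ} (f : TreeAut p) : f [] = [] := by
  by_contra hne
  obtain ⟨u, x, hu⟩ := (f []).eq_nil_or_concat'.resolve_left hne
  -- Degree count: a non-root vertex has a parent and `p` children, hence `p + 1` neighbours,
  -- whereas the root has only `p`.
  let nb : Option (Fin p) → List (Fin p) := fun o => o.elim u fun y => u ++ [x] ++ [y]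
  have hnb : Function.Injective nb := by
    intro o o' h
    have hl := congrArg List.length h
    cases o <;> cases o' <;> simp [nb] at h hl ⊢
    exact h
  have hz : ∀ o, ∃ z, f.symm (nb o) = [z] := by
    intro o
    have hadj : (tree p).Adj (f []) (nb o) := by
      rw [hu]
      cases o with
      | none => exact ⟨x, Or.inr rfl⟩
      | some y => exact ⟨y, Or.inl rfl⟩
    have h' := f.symm.map_rel_iff.mpr hadj
    obtain ⟨z, hz | hz⟩ := h'
    · exact ⟨z, by simpa using hz⟩
    · simp at hz
  choose z hz using hz
  have hinj : Function.Injective z := fun o o' h =>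
    hnb (f.symm.injective (by rw [hz, hz, h]))
  have := Fintype.card_le_of_injective z hinj
  simp at this

theorem treeAut_append_singleton {p : ℕ} (f : TreeAut p) (v : List (Fin p)) :
    (f v).length = v.length ∧ ∀ x, ∃ y, f (v ++ [x]) = f v ++ [y] := by
  induction v using List.reverseRecOn with
  | nil =>
    refine ⟨by simp [treeAut_nil], fun x => ?_⟩
    have hadj : (tree p).Adj [] [x] := ⟨x, Or.inl rfl⟩
    obtain ⟨y, h | h⟩ := f.map_rel_iff.mpr hadj
    · exact ⟨y, h⟩
    · rw [treeAut_nil] at h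
      simp at h
  | append_singleton v z ih =>
    obtain ⟨hl, hx⟩ := ih
    obtain ⟨z', hz'⟩ := hx z
    refine ⟨by simp [hz', hl], fun x => ?_⟩
    have hadj : (tree p).Adj (v ++ [z]) (v ++ [z] ++ [x]) := ⟨x, Or.inl rfl⟩
    obtain ⟨y, h | h⟩ := f.map_rel_iff.mpr hadj
    · exact ⟨y, h⟩
    · change f (v ++ [z]) = f (v ++ [z] ++ [x]) ++ [y] at h
      rw [hz'] at h
      have h2 := f.injective (List.append_inj_left' h rfl)
      have := congrArg List.length h2
      simp at this

@[simp] theorem treeAut_length {p : ℕ} (f : TreeAut p) (v : List (Fin p)) :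
    (f v).length = v.length :=
  (treeAut_append_singleton f v).1

theorem treeAut_prefix {p : ℕ} (f : TreeAut p) {u v : List (Fin p)} (h : u <+: v) :
    f u <+: f v := by
  obtain ⟨w, rfl⟩ := h
  induction w using List.reverseRecOn with
  | nil => simp
  | append_singleton w z ih =>
    obtain ⟨y, hy⟩ := (treeAut_append_singleton f (u ++ w)).2 z
    rw [← List.append_assoc, hy]
    exact ih.trans (List.prefix_append _ _)

/-- A word of the same length as `u` and distinct from it has no extension in common with it. -/
theorem not_prefix_of_prefix {α : Type*} {u v w : List α} (hl : u.length = v.length)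
    (hne : u ≠ v) (h : u <+: w) : ¬ v <+: w := fun h' =>
  hne ((List.prefix_of_prefix_length_le h h' hl.le).eq_of_length hl)

theorem exists_apply_ne {p : ℕ} {f : TreeAut p} (h : f ≠ 1) : ∃ v, f v ≠ v := by
  by_contra! hc
  exact h (RelIso.ext hc)

/-! ### Automorphisms supported on a subtree -/

/-- `f` fixes every word that does not extend `u`. -/
def SupportedOn {p : ℕ} (f : TreeAut p) (u : List (Fin p)) : Prop :=
  ∀ w, ¬ u <+: w → f w = w

namespace SupportedOn

variable {p : ℕ} {f g : TreeAut p} {u v w : List (Fin p)}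

theorem prefix_of_ne (h : SupportedOn f u) (hw : f w ≠ w) : u <+: w :=
  not_not.mp fun hn => hw (h w hn)

theorem apply_prefix (h : SupportedOn f u) (hw : u <+: w) : u <+: f w := by
  by_contra hn
  have := f.injective (h _ hn)
  exact hn (this.symm ▸ hw)

theorem apply_self (h : SupportedOn f u) : f u = u :=
  ((h.apply_prefix (List.prefix_refl u)).eq_of_length (by simp)).symm

theorem inv (h : SupportedOn f u) : SupportedOn f⁻¹ u := fun w hw => by
  conv_lhs => rw [← h w hw]
  exact RelIso.inv_apply_self f w

theorem mul (hf : SupportedOn f u) (hg : SupportedOn g u) : SupportedOn (f * g) u :=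
  fun w hw => by rw [RelIso.mul_apply, hg w hw, hf w hw]

theorem mono (h : SupportedOn f u) (hv : v <+: u) : SupportedOn f v :=
  fun w hw => h w fun h' => hw (hv.trans h')

theorem conj (h : SupportedOn f u) (k : TreeAut p) : SupportedOn (k * f * k⁻¹) (k u) := by
  intro w hw
  have : ¬ u <+: k⁻¹ w := fun h' => hw (by simpa using treeAut_prefix k h')
  simp [RelIso.mul_apply, h _ this]

theorem conj' (h : SupportedOn f u) {k : TreeAut p} (hk : k u = u) :
    SupportedOn (k * f * k⁻¹) u := by
  have := h.conj k
  rwa [hk] at this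

theorem commute (hf : SupportedOn f u) (hg : SupportedOn g v) (hl : u.length = v.length)
    (hne : u ≠ v) : Commute f g := by
  refine RelIso.ext fun w => ?_
  simp only [RelIso.mul_apply]
  by_cases hu : u <+: w
  · rw [hg w (not_prefix_of_prefix hl hne hu),
      hg _ (not_prefix_of_prefix hl hne (hf.apply_prefix hu))]
  · rw [hf w hu]
    by_cases hv : v <+: w
    · rw [hf _ (not_prefix_of_prefix hl.symm hne.symm (hg.apply_prefix hv))]
    · rw [hg w hv, hf w hu]

theorem eq_one (hf : SupportedOn f u) (hf' : SupportedOn f v) (hl : u.length = v.length)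
    (hne : u ≠ v) : f = 1 := by
  refine RelIso.ext fun w => ?_
  by_cases hu : u <+: w
  · exact hf' w (not_prefix_of_prefix hl hne hu)
  · exact hf w hu

/-- An automorphism that moves `u` commutes with no nontrivial one that is supported on `u`. -/
theorem not_commute (hf : SupportedOn f u) (hf1 : f ≠ 1) (hg : g u ≠ u) : ¬ Commute g f := by
  intro h
  refine hf1 (eq_one hf (v := g u) ?_ (by simp) hg.symm)
  have := hf.conj g
  rwa [h.eq, mul_inv_cancel_right] at this

end SupportedOn

/-! ### Sections -/

/-- `g` maps the subtree of `u` to that of `u'`, and acts there as `h`. -/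
def HasSection {p : ℕ} (g : TreeAut p) (u u' : List (Fin p)) (h : TreeAut p) : Prop :=
  ∀ v, g (u ++ v) = u' ++ h v

namespace HasSection

variable {p : ℕ} {g g' h h' : TreeAut p} {u u' u'' w w' : List (Fin p)}

theorem one (u : List (Fin p)) : HasSection 1 u u 1 := fun _ => rfl

theorem mul (hg : HasSection g u' u'' h) (hg' : HasSection g' u u' h') :
    HasSection (g * g') u u'' (h * h') := fun v => by
  rw [RelIso.mul_apply, hg', hg, RelIso.mul_apply]

theorem inv (hg : HasSection g u u' h) : HasSection g⁻¹ u' u h⁻¹ := fun v => by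
  apply g.injective
  rw [hg]
  simp

theorem pow (hg : HasSection g u u h) (n : ℕ) : HasSection (g ^ n) u u (h ^ n) := by
  induction n with
  | zero => simpa using one u
  | succ n ih => simpa [pow_succ] using ih.mul hg

theorem commutator (hg : HasSection g u u h) (hg' : HasSection g' u u h') :
    HasSection ⁅g, g'⁆ u u ⁅h, h'⁆ :=
  ((hg.mul hg').mul hg.inv).mul hg'.inv

theorem append (hg : HasSection g u u' h) (hh : HasSection h w w' h') :
    HasSection g (u ++ w) (u' ++ w') h' := fun v => by
  rw [List.append_assoc, hg, hh, List.append_assoc]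

theorem apply (hg : HasSection g u u' h) : g u = u' := by
  simpa [treeAut_nil] using hg []

theorem unique (hg : HasSection g u u' h) (hg' : HasSection g u u' h') : h = h' :=
  RelIso.ext fun v => List.append_cancel_left ((hg v).symm.trans (hg' v))

end HasSection

/-! ### The generators -/

theorem a_mem (p : ℕ) : a p ∈ basilica p := Subgroup.subset_closure (by simp)

theorem b_mem (p : ℕ) : b p ∈ basilica p := Subgroup.subset_closure (by simp)

theorem exists_letter_section {p : ℕ} {g : TreeAut p} (hg : g ∈ basilica p) :
    ∀ x, ∃ y, ∃ h ∈ basilica p, HasSection g [x] [y] h := by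
  induction hg using Subgroup.closure_induction with
  | mem g hg =>
    intro x
    rcases hg with rfl | rfl
    · refine ⟨x, if IsLast x then b p else 1, ?_, fun v => ?_⟩
      · split_ifs
        exacts [b_mem p, one_mem _]
      · rw [List.singleton_append, a_cons]
        split_ifs <;> rfl
    · refine ⟨finRotate p x, if IsLast x then a p else 1, ?_, fun v => ?_⟩
      · split_ifs
        exacts [a_mem p, one_mem _]
      · rw [List.singleton_append, b_cons]
        split_ifs <;> rfl
  | one => exact fun x => ⟨x, 1, one_mem _, HasSection.one _⟩
  | mul g g' _ _ ih ih' =>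
    intro x
    obtain ⟨y, h', hh', hs'⟩ := ih' x
    obtain ⟨z, h, hh, hs⟩ := ih y
    exact ⟨z, h * h', mul_mem hh hh', hs.mul hs'⟩
  | inv g _ ih =>
    intro x
    have hlen : (g⁻¹ [x]).length = 1 := by simp
    obtain ⟨z, hz⟩ := List.length_eq_one_iff.mp hlen
    obtain ⟨y, h, hh, hs⟩ := ih z
    have hy : g [z] = [x] := by rw [← hz]; simp
    rw [hs.apply] at hy
    exact ⟨z, h⁻¹, inv_mem hh, hy ▸ hs.inv⟩

theorem exists_section {p : ℕ} {g : TreeAut p} (hg : g ∈ basilica p) (u : List (Fin p)) :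
    ∃ h ∈ basilica p, HasSection g u (g u) h := by
  suffices ∃ u', ∃ h ∈ basilica p, HasSection g u u' h by
    obtain ⟨u', h, hh, hs⟩ := this
    exact ⟨h, hh, by rwa [hs.apply]⟩
  induction u generalizing g with
  | nil => exact ⟨[], g, hg, fun v => rfl⟩
  | cons x u ih =>
    obtain ⟨y, h, hh, hs⟩ := exists_letter_section hg x
    obtain ⟨u', k, hk, hs'⟩ := ih hh
    exact ⟨[y] ++ u', k, hk, hs.append hs'⟩

/-- `g` acts on the first letters as the translation by `k` of `Fin p = ℤ/pℤ`. -/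
def ShiftsBy {p : ℕ} (g : TreeAut p) (k : Fin p) : Prop :=
  ∀ x, g [x] = [x + k]

-- The action on the first level

section

variable {p : ℕ} [Fact p.Prime]

theorem ShiftsBy.mul {g h : TreeAut p} {k l : Fin p} (hg : ShiftsBy g k) (hh : ShiftsBy h l) :
    ShiftsBy (g * h) (k + l) := fun x => by
  rw [RelIso.mul_apply, hh, hg, add_assoc, add_comm l]

theorem ShiftsBy.inv {g : TreeAut p} {k : Fin p} (hg : ShiftsBy g k) : ShiftsBy g⁻¹ (-k) :=
  fun x => by
    apply g.injective
    rw [hg]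
    simp

theorem ShiftsBy.pow {g : TreeAut p} {k : Fin p} (hg : ShiftsBy g k) (n : ℕ) :
    ShiftsBy (g ^ n) (n • k) := by
  induction n with
  | zero => exact fun x => by simp
  | succ n ih => rw [pow_succ, succ_nsmul]; exact ih.mul hg

theorem shiftsBy_b : ShiftsBy (b p) 1 := fun x => by
  rw [b_cons, finRotate_apply]
  split_ifs <;> simp [treeAut_nil]

theorem exists_shiftsBy {g : TreeAut p} (hg : g ∈ basilica p) : ∃ k, ShiftsBy g k := by
  induction hg using Subgroup.closure_induction with
  | mem g hg =>
    rcases hg with rfl | rfl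
    · refine ⟨0, fun x => ?_⟩
      rw [a_cons]
      split_ifs <;> simp [treeAut_nil]
    · exact ⟨1, shiftsBy_b⟩
  | one => exact ⟨0, fun x => by simp⟩
  | mul g h _ _ ih ih' =>
    obtain ⟨k, hk⟩ := ih
    obtain ⟨l, hl⟩ := ih'
    exact ⟨k + l, hk.mul hl⟩
  | inv g _ ih =>
    obtain ⟨k, hk⟩ := ih
    exact ⟨-k, hk.inv⟩

/-- The group acts on first letters through translations of $\mathbb Z/p$, an abelian group of
exponent $p$; hence the choice of $p$-th powers and commutators in the series below. -/
theorem pow_apply_singleton {g : TreeAut p} (hg : g ∈ basilica p) (x : Fin p) :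
    (g ^ p) [x] = [x] := by
  obtain ⟨k, hk⟩ := exists_shiftsBy hg
  have h0 : p • k = 0 := by simpa using card_nsmul_eq_zero (x := k)
  rw [hk.pow, h0, add_zero]

theorem commutator_apply_singleton {g h : TreeAut p} (hg : g ∈ basilica p)
    (hh : h ∈ basilica p) (x : Fin p) : ⁅g, h⁆ [x] = [x] := by
  obtain ⟨k, hk⟩ := exists_shiftsBy hg
  obtain ⟨l, hl⟩ := exists_shiftsBy hh
  have := (((hk.mul hl).mul hk.inv).mul hl.inv) x
  rw [commutatorElement_def, this]
  simp

variable (p) in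
/-- The last letter of the alphabet. -/
def lastLetter : Fin p := ⟨p - 1, Nat.sub_lt (Fact.out : p.Prime).pos one_pos⟩

theorem isLast_iff {x : Fin p} : IsLast x ↔ x = lastLetter p := by
  have := (Fact.out : p.Prime).pos
  simp only [IsLast, lastLetter, Fin.ext_iff]
  omega

theorem lastLetter_add_one_ne : lastLetter p + 1 ≠ lastLetter p := by
  simpa using (Fact.out : p.Prime).ne_one

theorem hasSection_a_last : HasSection (a p) [lastLetter p] [lastLetter p] (b p) := fun v => by
  rw [List.singleton_append, a_cons, if_pos (isLast_iff.mpr rfl)]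
  rfl

theorem hasSection_a_of_ne {x : Fin p} (hx : x ≠ lastLetter p) : HasSection (a p) [x] [x] 1 :=
  fun v => by
    rw [List.singleton_append, a_cons, if_neg (mt isLast_iff.mp hx)]
    rfl

theorem hasSection_b_last : HasSection (b p) [lastLetter p] [lastLetter p + 1] (a p) :=
  fun v => by
    rw [List.singleton_append, b_cons, if_pos (isLast_iff.mpr rfl), finRotate_apply]
    rfl

theorem hasSection_b_of_ne {x : Fin p} (hx : x ≠ lastLetter p) :
    HasSection (b p) [x] [x + 1] 1 := fun v => by
  rw [List.singleton_append, b_cons, if_neg (mt isLast_iff.mp hx), finRotate_apply]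
  rfl

theorem hasSection_b_pow_of_lt (x y : Fin p) (j : ℕ) (hj : (x : ℕ) + j = y) :
    HasSection (b p ^ j) [x] [y] 1 := by
  induction j generalizing y with
  | zero =>
    obtain rfl : x = y := Fin.ext hj
    simpa using HasSection.one [x]
  | succ j ih =>
    have hlt : (x : ℕ) + j + 1 < p := by have := y.2; omega
    let z : Fin p := ⟨x + j, by omega⟩
    have hz : z ≠ lastLetter p := fun h => by
      have := congrArg Fin.val h
      simp only [z, lastLetter] at this
      omega
    have hzy : z + 1 = y := by
      rw [← finRotate_apply z]
      refine Fin.ext ?_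
      obtain ⟨n, rfl⟩ : ∃ n, p = n + 1 := ⟨p - 1, by omega⟩
      rw [coe_finRotate_of_ne_last]
      · simp only [z]; omega
      · intro h
        have := congrArg Fin.val h
        simp only [z, Fin.val_last] at this
        omega
    have h2 := (hasSection_b_of_ne hz).mul (ih z rfl)
    rw [hzy, ← pow_succ'] at h2
    simpa using h2

theorem exists_apply_singleton (x y : Fin p) : ∃ g ∈ basilica p, g [x] = [y] := by
  refine ⟨b p ^ (y : ℕ) * (b p ^ (x : ℕ))⁻¹,
    mul_mem (pow_mem (b_mem p) _) (inv_mem (pow_mem (b_mem p) _)), ?_⟩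
  have hx := hasSection_b_pow_of_lt 0 x x (by simp)
  have hy := hasSection_b_pow_of_lt 0 y y (by simp)
  exact (hy.mul hx.inv).apply

/-- The orbit of `x` under the `p`-cycle meets the last letter exactly once, and only there does `b`
have a nontrivial section. -/
theorem hasSection_b_pow (x : Fin p) : HasSection (b p ^ p) [x] [x] (a p) := by
  have hp := (Fact.out : p.Prime).pos
  have hx := x.2
  have h1 := hasSection_b_pow_of_lt x (lastLetter p) (p - 1 - x)
    (by simp only [lastLetter]; omega)
  have h0 : lastLetter p + 1 = 0 := by
    obtain ⟨n, rfl⟩ : ∃ n, p = n + 1 := ⟨p - 1, by omega⟩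
    exact Fin.last_add_one n
  have h3 := hasSection_b_pow_of_lt (lastLetter p + 1) x x (by simp [h0])
  have h := h3.mul (hasSection_b_last.mul h1)
  rw [← pow_succ', ← pow_add] at h
  have e : (x : ℕ) + (p - 1 - x + 1) = p := by omega
  simpa [e] using h

/-- The commutator of the generators acts as `b` on the subtree of the last letter. -/
theorem hasSection_commutator_last :
    HasSection ⁅a p, b p⁆ [lastLetter p] [lastLetter p] (b p) := by
  -- `x` is the letter that `b` sends to the last one. As it is not the last letter itself, `b` and
  -- `a` both have trivial section there, so only the outer `a` contributes.
  obtain ⟨x, hx⟩ : ∃ x : Fin p, x + 1 = lastLetter p := ⟨lastLetter p - 1, by simp⟩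
  have hne : x ≠ lastLetter p := fun h => lastLetter_add_one_ne (h ▸ hx)
  have hb := hasSection_b_of_ne hne
  rw [hx] at hb
  have := ((hasSection_a_last.mul hb).mul (hasSection_a_of_ne hne).inv).mul hb.inv
  rw [inv_one, mul_one, mul_one, mul_one] at this
  exact this

theorem b_ne_one : b p ≠ 1 := fun h => by
  have := shiftsBy_b (lastLetter p)
  rw [h] at this
  exact lastLetter_add_one_ne (List.singleton_injective this).symm

theorem commutator_ne_one : ⁅a p, b p⁆ ≠ 1 := fun h => by
  have h1 := hasSection_commutator_last (p := p)
  rw [h] at h1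
  exact b_ne_one (h1.unique (HasSection.one _))

end

/-! ### The series of verbal subgroups -/

/-- The series `Γ_0 = Γ`, `Γ_{n+1} = Γ_n^p [Γ_n, Γ_n]`. -/
def powerSeriesSubgroup (p : ℕ) (Γ : Type*) [Group Γ] : ℕ → Subgroup Γ
  | 0 => ⊤
  | n + 1 => Subgroup.closure
      ({z | ∃ g ∈ powerSeriesSubgroup p Γ n, g ^ p = z} ∪
        {z | ∃ g ∈ powerSeriesSubgroup p Γ n, ∃ h ∈ powerSeriesSubgroup p Γ n, ⁅g, h⁆ = z})

section

variable {p : ℕ} {Γ : Type*} [Group Γ] {n : ℕ} {g h : Γ}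

theorem pow_mem_powerSeries (hg : g ∈ powerSeriesSubgroup p Γ n) :
    g ^ p ∈ powerSeriesSubgroup p Γ (n + 1) :=
  Subgroup.subset_closure (Or.inl ⟨g, hg, rfl⟩)

theorem commutator_mem_powerSeries (hg : g ∈ powerSeriesSubgroup p Γ n)
    (hh : h ∈ powerSeriesSubgroup p Γ n) : ⁅g, h⁆ ∈ powerSeriesSubgroup p Γ (n + 1) :=
  Subgroup.subset_closure (Or.inr ⟨g, hg, h, hh, rfl⟩)

theorem powerSeries_succ_induction {P : Γ → Prop}
    (pow : ∀ g ∈ powerSeriesSubgroup p Γ n, P (g ^ p))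
    (comm : ∀ g ∈ powerSeriesSubgroup p Γ n, ∀ h ∈ powerSeriesSubgroup p Γ n, P ⁅g, h⁆)
    (one : P 1) (mul : ∀ x y, P x → P y → P (x * y)) (inv : ∀ x, P x → P x⁻¹)
    (hg : g ∈ powerSeriesSubgroup p Γ (n + 1)) : P g := by
  change g ∈ Subgroup.closure _ at hg
  induction hg using Subgroup.closure_induction with
  | mem z hz =>
    rcases hz with ⟨g, hg, rfl⟩ | ⟨g, hg, h, hh, rfl⟩
    exacts [pow g hg, comm g hg h hh]
  | one => exact one
  | mul x y _ _ hx hy => exact mul x y hx hy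
  | inv x _ hx => exact inv x hx

theorem powerSeries_succ_le : powerSeriesSubgroup p Γ (n + 1) ≤ powerSeriesSubgroup p Γ n :=
  fun _ hg => powerSeries_succ_induction (fun _ h => pow_mem h p)
    (fun _ h _ h' => mul_mem (mul_mem (mul_mem h h') (inv_mem h)) (inv_mem h'))
    (one_mem _) (fun _ _ => mul_mem) (fun _ => inv_mem) hg

/-- The series is verbal, hence characteristic; inner automorphisms give normality. -/
theorem map_mem_powerSeries (α : MulAut Γ) (hg : g ∈ powerSeriesSubgroup p Γ n) :
    α g ∈ powerSeriesSubgroup p Γ n := by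
  induction n generalizing g with
  | zero => trivial
  | succ n ih =>
    refine powerSeries_succ_induction (P := fun g => α g ∈ powerSeriesSubgroup p Γ (n + 1))
      (fun g h => ?_) (fun g h g' h' => ?_) ?_ (fun x y hx hy => ?_) (fun x hx => ?_) hg
    · rw [map_pow]
      exact pow_mem_powerSeries (ih h)
    · rw [map_commutatorElement]
      exact commutator_mem_powerSeries (ih h) (ih h')
    · simp [one_mem]
    · rw [map_mul]
      exact mul_mem hx hy
    · rw [map_inv]
      exact inv_mem hx

instance powerSeries_normal : (powerSeriesSubgroup p Γ n).Normal :=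
  ⟨fun _ hg k => map_mem_powerSeries (MulAut.conj k) hg⟩

end

variable {p : ℕ}

/-- If every generator is the section at `u` of an element of `K`, then so is every element of
the group. -/
theorem exists_hasSection_of_generators (K : Subgroup (basilica p)) {u : List (Fin p)}
    (ha : ∃ g ∈ K, HasSection (g : TreeAut p) u u (a p))
    (hb : ∃ g ∈ K, HasSection (g : TreeAut p) u u (b p)) {h : TreeAut p} (hh : h ∈ basilica p) :
    ∃ g ∈ K, HasSection (g : TreeAut p) u u h := by
  induction hh using Subgroup.closure_induction with
  | mem h hh =>
    rcases hh with rfl | rfl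
    exacts [ha, hb]
  | one => exact ⟨1, one_mem _, HasSection.one _⟩
  | mul x y _ _ hx hy =>
    obtain ⟨g, hg, hs⟩ := hx
    obtain ⟨g', hg', hs'⟩ := hy
    exact ⟨g * g', mul_mem hg hg', hs.mul hs'⟩
  | inv x _ hx =>
    obtain ⟨g, hg, hs⟩ := hx
    exact ⟨g⁻¹, inv_mem hg, hs.inv⟩

/-- The generator `a` of the group, as an element of it. -/
def genA (p : ℕ) : basilica p := ⟨a p, a_mem p⟩

/-- The generator `b` of the group, as an element of it. -/
def genB (p : ℕ) : basilica p := ⟨b p, b_mem p⟩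

variable (p) in
/-- The normal closure of the commutator of the two generators. -/
def commutatorClosure : Subgroup (basilica p) := Subgroup.normalClosure {⁅genA p, genB p⁆}

instance : (commutatorClosure p).Normal := Subgroup.normalClosure_normal

theorem commutator_genA_pow_mem (n : ℕ) : ⁅genA p, genB p ^ n⁆ ∈ commutatorClosure p := by
  rw [← QuotientGroup.eq_one_iff]
  have h : ((⁅genA p, genB p⁆ : basilica p) : basilica p ⧸ commutatorClosure p) = 1 :=
    (QuotientGroup.eq_one_iff _).mpr (Subgroup.subset_normalClosure rfl)
  have hc : Commute (genA p : basilica p ⧸ commutatorClosure p) (genB p) :=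
    commutatorElement_eq_one_iff_commute.mp h
  exact commutatorElement_eq_one_iff_commute.mpr (hc.pow_right n)

/-- `f` fixes the words that do not begin with `x`, and acts as `g` below `x`. -/
def IsInsertion (x : Fin p) (f g : TreeAut p) : Prop :=
  SupportedOn f [x] ∧ HasSection f [x] [x] g

theorem IsInsertion.conj {x y : Fin p} {f g k t : TreeAut p} (h : IsInsertion x f g)
    (hk : HasSection k [x] [y] t) : IsInsertion y (k * f * k⁻¹) (t * g * t⁻¹) := by
  have := h.1.conj k
  rw [hk.apply] at this
  exact ⟨this, (hk.mul h.2).mul hk.inv⟩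

-- How the series acts on the levels

variable [Fact p.Prime]

theorem powerSeries_apply {n : ℕ} {g : basilica p}
    (hg : g ∈ powerSeriesSubgroup p (basilica p) n) {u : List (Fin p)} (hu : u.length = n) :
    (g : TreeAut p) u = u := by
  induction n generalizing g u with
  | zero => rw [List.length_eq_zero_iff.mp hu, treeAut_nil]
  | succ n ih =>
    obtain ⟨u, x, rfl⟩ : ∃ v x, u = v ++ [x] :=
      u.eq_nil_or_concat'.resolve_left (by rintro rfl; simp at hu)
    have hu' : u.length = n := by simpa using hu
    have hsec : ∀ g ∈ powerSeriesSubgroup p (basilica p) n,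
        ∃ h ∈ basilica p, HasSection (g : TreeAut p) u u h := fun g hg => by
      obtain ⟨h, hh, hs⟩ := exists_section g.2 u
      rw [ih hg hu'] at hs
      exact ⟨h, hh, hs⟩
    refine powerSeries_succ_induction
      (P := fun g : basilica p => (g : TreeAut p) (u ++ [x]) = u ++ [x])
      (fun g hg => ?_) (fun g hg g' hg' => ?_) rfl (fun y z hy hz => ?_) (fun y hy => ?_) hg
    · obtain ⟨h, hh, hs⟩ := hsec g hg
      have := hs.pow p [x]
      rw [pow_apply_singleton hh] at this
      exact this
    · obtain ⟨h, hh, hs⟩ := hsec g hg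
      obtain ⟨h', hh', hs'⟩ := hsec g' hg'
      have := hs.commutator hs' [x]
      rw [commutator_apply_singleton hh hh'] at this
      exact this
    · rw [Subgroup.coe_mul, RelIso.mul_apply, hz, hy]
    · apply (y : TreeAut p).injective
      rw [hy]
      simp

theorem powerSeries_apply_of_le {n : ℕ} {g : basilica p}
    (hg : g ∈ powerSeriesSubgroup p (basilica p) n) {u : List (Fin p)} (hu : u.length ≤ n) :
    (g : TreeAut p) u = u := by
  let z : List (Fin p) := List.replicate (n - u.length) (lastLetter p)
  have h : (g : TreeAut p) (u ++ z) = u ++ z :=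
    powerSeries_apply hg (by simp only [z, List.length_append, List.length_replicate]; omega)
  have h1 := treeAut_prefix (g : TreeAut p) (List.prefix_append u z)
  rw [h] at h1
  exact (List.prefix_of_prefix_length_le h1 (List.prefix_append u z)
    (by simp)).eq_of_length (by simp)

/-- At the last letter, $b^p$ and $[a,b]$ have sections $a$ and $b$. Conjugation reaches the other
letters, once `h` is corrected by the section `t` of the conjugator. -/
theorem exists_hasSection_singleton (x : Fin p) {h : TreeAut p} (hh : h ∈ basilica p) :
    ∃ g ∈ powerSeriesSubgroup p (basilica p) 1, HasSection (g : TreeAut p) [x] [x] h := by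
  obtain ⟨k, hk, hkx⟩ := exists_apply_singleton (lastLetter p) x
  obtain ⟨t, ht, hs⟩ := exists_section hk [lastLetter p]
  rw [hkx] at hs
  obtain ⟨g, hg, hgs⟩ := exists_hasSection_of_generators
    (powerSeriesSubgroup p (basilica p) 1) (u := [lastLetter p])
    ⟨genB p ^ p, pow_mem_powerSeries (n := 0) trivial, hasSection_b_pow _⟩
    ⟨⁅genA p, genB p⁆, commutator_mem_powerSeries (n := 0) trivial trivial,
      hasSection_commutator_last⟩ (mul_mem (mul_mem (inv_mem ht) hh) ht)
  lift k to basilica p using hk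
  refine ⟨k * g * k⁻¹, powerSeries_normal.conj_mem g hg k, ?_⟩
  have := (hs.mul hgs).mul hs.inv
  rwa [show t * (t⁻¹ * h * t) * t⁻¹ = h by group] at this

theorem exists_powerSeries_hasSection {n : ℕ} {u : List (Fin p)} (hu : u.length = n)
    {h : TreeAut p} (hh : h ∈ basilica p) :
    ∃ g ∈ powerSeriesSubgroup p (basilica p) n, HasSection (g : TreeAut p) u u h := by
  induction n generalizing u h with
  | zero =>
    rw [List.length_eq_zero_iff.mp hu]
    exact ⟨⟨h, hh⟩, trivial, fun v => rfl⟩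
  | succ n ih =>
    obtain ⟨u, x, rfl⟩ : ∃ v x, u = v ++ [x] :=
      u.eq_nil_or_concat'.resolve_left (by rintro rfl; simp at hu)
    have hu' : u.length = n := by simpa using hu
    -- Elements of $\Gamma_1$ are built from $p$-th powers and commutators in $G$. Lifting the
    -- entries to $\Gamma_n$ by induction puts the lifted powers and commutators in $\Gamma_{n+1}$.
    have key : ∀ k ∈ powerSeriesSubgroup p (basilica p) 1,
        ∃ g ∈ powerSeriesSubgroup p (basilica p) (n + 1),
          HasSection (g : TreeAut p) u u (k : TreeAut p) := fun k hk => by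
      refine powerSeries_succ_induction
        (P := fun k : basilica p => ∃ g ∈ powerSeriesSubgroup p (basilica p) (n + 1),
          HasSection (g : TreeAut p) u u (k : TreeAut p))
        (fun k _ => ?_) (fun k _ k' _ => ?_) ⟨1, one_mem _, HasSection.one _⟩
        (fun y z hy hz => ?_) (fun y hy => ?_) hk
      · obtain ⟨g, hg, hs⟩ := ih hu' k.2
        exact ⟨g ^ p, pow_mem_powerSeries hg, hs.pow p⟩
      · obtain ⟨g, hg, hs⟩ := ih hu' k.2
        obtain ⟨g', hg', hs'⟩ := ih hu' k'.2
        exact ⟨⁅g, g'⁆, commutator_mem_powerSeries hg hg', hs.commutator hs'⟩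
      · obtain ⟨g, hg, hs⟩ := hy
        obtain ⟨g', hg', hs'⟩ := hz
        exact ⟨g * g', mul_mem hg hg', hs.mul hs'⟩
      · obtain ⟨g, hg, hs⟩ := hy
        exact ⟨g⁻¹, inv_mem hg, hs.inv⟩
    obtain ⟨k, hk, hks⟩ := exists_hasSection_singleton x hh
    obtain ⟨g, hg, hs⟩ := key k hk
    exact ⟨g, hg, hs.append hks⟩

theorem powerSeries_ne_bot (n : ℕ) : powerSeriesSubgroup p (basilica p) n ≠ ⊥ := fun h => by
  obtain ⟨g, hg, hs⟩ := exists_powerSeries_hasSection (n := n)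
    (u := List.replicate n (lastLetter p)) (by simp) (b_mem p)
  rw [h, Subgroup.mem_bot] at hg
  rw [hg] at hs
  exact b_ne_one (hs.unique (HasSection.one _))

/-- The group acts transitively on each level of the tree. -/
theorem exists_apply_eq {u v : List (Fin p)} (h : u.length = v.length) :
    ∃ g : basilica p, (g : TreeAut p) u = v := by
  induction u generalizing v with
  | nil => exact ⟨1, by simpa using (List.length_eq_zero_iff.mp h.symm).symm⟩
  | cons x u ih =>
    obtain ⟨y, v, rfl⟩ := List.exists_cons_of_ne_nil (l := v) (by rintro rfl; simp at h)
    obtain ⟨k, hk, hkx⟩ := exists_apply_singleton x y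
    obtain ⟨t, -, hs⟩ := exists_section hk [x]
    rw [hkx] at hs
    -- The target is `t⁻¹ v` because `k` will afterwards act by `t` below `x`.
    obtain ⟨r, hr⟩ := ih (v := t⁻¹ v) (by simpa using h)
    obtain ⟨g, -, hg⟩ := exists_hasSection_singleton x r.2
    refine ⟨⟨k, hk⟩ * g, ?_⟩
    have := (hs.mul hg) u
    rw [RelIso.mul_apply t, hr, RelIso.apply_inv_self] at this
    exact this

/-! ### Rigid stabilisers -/

variable (p) in
/-- The elements whose insertion below the last letter lies in `commutatorClosure p`. -/
def insertable : Subgroup (basilica p) where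
  carrier := {g | ∃ f ∈ commutatorClosure p, IsInsertion (lastLetter p) (f : TreeAut p) g}
  one_mem' := ⟨1, one_mem _, fun _ _ => rfl, HasSection.one _⟩
  mul_mem' := by
    rintro g g' ⟨f, hf, hs⟩ ⟨f', hf', hs'⟩
    exact ⟨f * f', mul_mem hf hf', hs.1.mul hs'.1, hs.2.mul hs'.2⟩
  inv_mem' := by
    rintro g ⟨f, hf, hs⟩
    exact ⟨f⁻¹, inv_mem hf, hs.1.inv, hs.2.inv⟩

/-- Conjugation by `t` below the last letter is realised by a group element fixing that letter with
section `t` there. -/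
instance : (insertable p).Normal := ⟨by
  rintro g ⟨f, hf, hs⟩ t
  obtain ⟨k, -, hk⟩ := exists_hasSection_singleton (lastLetter p) t.2
  exact ⟨k * f * k⁻¹, Subgroup.Normal.conj_mem inferInstance f hf k, hs.conj hk⟩⟩

/-- By normality one generator suffices. The commutator $[a,b^p]$ is trivial away from the last
letter, where its section is $[b,a]=[a,b]^{-1}$. -/
theorem commutatorClosure_le_insertable : commutatorClosure p ≤ insertable p := by
  refine Subgroup.normalClosure_le_normal (Set.singleton_subset_iff.mpr ?_)
  rw [SetLike.mem_coe, ← inv_mem_iff, commutatorElement_inv]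
  refine ⟨⁅genA p, genB p ^ p⁆, commutator_genA_pow_mem p, fun w hw => ?_,
    hasSection_a_last.commutator (hasSection_b_pow _)⟩
  cases w with
  | nil => exact treeAut_nil _
  | cons x v =>
    have hx : x ≠ lastLetter p := by
      rintro rfl
      exact hw (List.prefix_append [lastLetter p] v)
    have := ((hasSection_a_of_ne hx).commutator (hasSection_b_pow x)) v
    rw [commutatorElement_one_left] at this
    exact this

theorem exists_isInsertion (x : Fin p) {g : basilica p} (hg : g ∈ commutatorClosure p) :
    ∃ f ∈ commutatorClosure p, IsInsertion x (f : TreeAut p) g := by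
  obtain ⟨k, hk, hkx⟩ := exists_apply_singleton (lastLetter p) x
  obtain ⟨t, ht, hs⟩ := exists_section hk [lastLetter p]
  rw [hkx] at hs
  lift k to basilica p using hk
  lift t to basilica p using ht
  obtain ⟨f, hf, hfi⟩ := commutatorClosure_le_insertable
    (Subgroup.Normal.conj_mem inferInstance g hg t⁻¹)
  refine ⟨k * f * k⁻¹, Subgroup.Normal.conj_mem inferInstance f hf k, ?_⟩
  have := hfi.conj hs
  have e := congrArg Subtype.val (show t * (t⁻¹ * g * t⁻¹⁻¹) * t⁻¹ = g by group)
  rw [Subgroup.coe_mul, Subgroup.coe_mul, Subgroup.coe_inv] at e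
  rwa [e] at this

theorem exists_supportedOn (u : List (Fin p)) :
    ∃ g ∈ commutatorClosure p, g ≠ 1 ∧ SupportedOn (g : TreeAut p) u := by
  induction u with
  | nil =>
    refine ⟨⁅genA p, genB p⁆, Subgroup.subset_normalClosure rfl, fun h => ?_,
      fun w hw => absurd List.nil_prefix hw⟩
    exact commutator_ne_one (congrArg Subtype.val h)
  | cons x u ih =>
    obtain ⟨g, hg, hg1, hgu⟩ := ih
    obtain ⟨f, hf, hfx, hfs⟩ := exists_isInsertion x hg
    refine ⟨f, hf, ?_, fun w hw => ?_⟩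
    · rintro rfl
      exact hg1 (Subtype.ext (hfs.unique (HasSection.one _)))
    · by_cases hx : [x] <+: w
      · obtain ⟨v, rfl⟩ := hx
        rw [hfs, hgu v]
        exact fun h => hw (by simpa using h)
      · exact hfx w hx

/-! ### Normal subgroups and rigid stabilisers -/

theorem commute_coe {p : ℕ} {g h : basilica p} :
    Commute (g : TreeAut p) (h : TreeAut p) ↔ Commute g h :=
  ⟨fun e => Subtype.ext e, fun e => congrArg Subtype.val e⟩

theorem exists_coe_apply_ne {p : ℕ} {g : basilica p} (h : g ≠ 1) :
    ∃ v, (g : TreeAut p) v ≠ v :=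
  exists_apply_ne fun e => h (Subtype.ext e)

/-- Take `r` supported on `w`, a word `z` that it moves, and `s` supported on `z`. -/
theorem exists_noncommuting_supportedOn (w : List (Fin p)) :
    ∃ r s : basilica p, SupportedOn (r : TreeAut p) w ∧ SupportedOn (s : TreeAut p) w ∧
      ¬ Commute r s := by
  obtain ⟨r, -, hr1, hr⟩ := exists_supportedOn w
  obtain ⟨z, hz⟩ := exists_coe_apply_ne hr1
  obtain ⟨s, -, hs1, hs⟩ := exists_supportedOn z
  refine ⟨r, s, hr, hs.mono (hr.prefix_of_ne hz), fun h => ?_⟩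
  exact hs.not_commute (fun e => hs1 (Subtype.ext e)) hz (commute_coe.mpr h)

/-- A nontrivial normal subgroup meets every rigid stabiliser nontrivially. -/
theorem exists_mem_supportedOn (N : Subgroup (basilica p)) [hN : N.Normal] (hne : N ≠ ⊥)
    (w : List (Fin p)) : ∃ m ∈ N, m ≠ 1 ∧ SupportedOn (m : TreeAut p) w := by
  obtain ⟨y, hyN, hy1⟩ := N.bot_or_exists_ne_one.resolve_left hne
  obtain ⟨v, hv⟩ := exists_coe_apply_ne hy1
  -- Padding makes the lengths equal, so that transitivity yields a conjugate of `y` moving an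
  -- extension of `w`.
  let v' := v ++ List.replicate w.length (lastLetter p)
  let w' := w ++ List.replicate v.length (lastLetter p)
  have hv' : (y : TreeAut p) v' ≠ v' := fun h => by
    have h1 := treeAut_prefix (y : TreeAut p) (List.prefix_append v _ : v <+: v')
    rw [h] at h1
    exact not_prefix_of_prefix (by simp) hv h1 (List.prefix_append v _)
  obtain ⟨k, hk⟩ := exists_apply_eq (p := p) (u := v') (v := w') (by simp [v', w', add_comm])
  have hzN := hN.conj_mem y hyN k
  set z := k * y * k⁻¹ with hz
  have hzw : (z : TreeAut p) w' ≠ w' := by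
    rw [← hk, hz]
    simp only [Subgroup.coe_mul, Subgroup.coe_inv, RelIso.mul_apply, RelIso.inv_apply_self]
    exact fun h => hv' ((k : TreeAut p).injective h)
  obtain ⟨r, s, hr, hs, hrs⟩ := exists_noncommuting_supportedOn w'
  have hA : Commute (z * r * z⁻¹) s := commute_coe.mp ((hr.conj z).commute hs (by simp) hzw)
  have hAr : Commute (z * r * z⁻¹) r := commute_coe.mp ((hr.conj z).commute hr (by simp) hzw)
  -- Since `z` moves `w'`, the conjugate `z * r * z⁻¹` is supported elsewhere and cancels. What
  -- remains of the double commutator, which lies in `N`, is supported on `w'`.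
  have e : ⁅⁅z, r⁆, s⁆ = r⁻¹ * s * r * s⁻¹ := by
    have h1 : Commute (z * r * z⁻¹) (r⁻¹ * s * r) := (hAr.inv_right.mul_right hA).mul_right hAr
    calc ⁅⁅z, r⁆, s⁆ = (z * r * z⁻¹) * (r⁻¹ * s * r) * (z * r * z⁻¹)⁻¹ * s⁻¹ := by
          simp only [commutatorElement_def]; group
      _ = _ := by rw [h1.eq, mul_inv_cancel_right]
  have hmem : ∀ x ∈ N, ∀ t : basilica p, ⁅x, t⁆ ∈ N := fun x hx t => by
    have := mul_mem hx (hN.conj_mem x⁻¹ (inv_mem hx) t)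
    rwa [← mul_assoc, ← mul_assoc, ← commutatorElement_def] at this
  refine ⟨r⁻¹ * s * r * s⁻¹, e ▸ hmem _ (hmem z hzN r) s, fun h => hrs ?_, ?_⟩
  · have h2 : r⁻¹ * s * r = s := mul_inv_eq_one.mp h
    rw [mul_assoc, inv_mul_eq_iff_eq_mul] at h2
    exact h2.symm
  · exact (((hr.inv.mul hs).mul hr).mul hs.inv).mono (List.prefix_append _ _)

/-- Otherwise `x` centralises the normal closure of `y`, which has a nontrivial element supported
below a word moved by `x`. -/
theorem exists_not_commute_conj {x y : basilica p} (hx : x ≠ 1) (hy : y ≠ 1) :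
    ∃ g, ¬ Commute x (g * y * g⁻¹) := by
  by_contra! hc
  have hle : Subgroup.normalClosure {y} ≤ Subgroup.centralizer {x} := by
    rw [Subgroup.normalClosure, Subgroup.closure_le]
    intro t ht
    obtain ⟨s, rfl, hs⟩ := Group.mem_conjugatesOfSet_iff.mp ht
    obtain ⟨c, rfl⟩ := isConj_iff.mp hs
    exact Subgroup.mem_centralizer_singleton_iff.mpr (hc c).symm
  have hne : Subgroup.normalClosure {y} ≠ ⊥ := fun h =>
    hy (Subgroup.mem_bot.mp (h ▸ Subgroup.subset_normalClosure rfl))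
  obtain ⟨z, hz⟩ := exists_coe_apply_ne hx
  obtain ⟨m, hm, hm1, hmz⟩ := exists_mem_supportedOn _ hne z
  refine hmz.not_commute (fun e => hm1 (Subtype.ext e)) hz (commute_coe.mpr ?_)
  exact (Subgroup.mem_centralizer_singleton_iff.mp (hle hm)).symm

/-- Elements supported on the same subtree do not commute with all conjugates of each other
by the level subgroup. -/
theorem exists_powerSeries_not_commute_conj {u : List (Fin p)} {x y : basilica p}
    (hx : x ≠ 1) (hy : y ≠ 1) (hxu : SupportedOn (x : TreeAut p) u)
    (hyu : SupportedOn (y : TreeAut p) u) :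
    ∃ h ∈ powerSeriesSubgroup p (basilica p) u.length, ¬ Commute x (h * y * h⁻¹) := by
  have key : ∀ z : basilica p, z ≠ 1 → SupportedOn (z : TreeAut p) u →
      ∃ t : basilica p, t ≠ 1 ∧ HasSection (z : TreeAut p) u u t := fun z hz hzu => by
    obtain ⟨t, ht, hs⟩ := exists_section z.2 u
    rw [hzu.apply_self] at hs
    refine ⟨⟨t, ht⟩, fun h1 => ?_, hs⟩
    obtain ⟨w, hw⟩ := exists_coe_apply_ne hz
    obtain ⟨w', rfl⟩ := hzu.prefix_of_ne hw
    obtain rfl : t = 1 := congrArg Subtype.val h1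
    exact hw (hs w')
  obtain ⟨s, hs1, hs⟩ := key x hx hxu
  obtain ⟨t, ht1, ht⟩ := key y hy hyu
  obtain ⟨g, hg⟩ := exists_not_commute_conj hs1 ht1
  -- The conjugator found for the sections at `u` is itself the section of an element of the level
  -- subgroup.
  obtain ⟨h, hh, hhs⟩ := exists_powerSeries_hasSection (u := u) rfl g.2
  refine ⟨h, hh, fun hc => hg ?_⟩
  have h1 := hs.mul ((hhs.mul ht).mul hhs.inv)
  have h2 := ((hhs.mul ht).mul hhs.inv).mul hs
  have hc' : (x : TreeAut p) * (h * y * (h : TreeAut p)⁻¹) = h * y * (h : TreeAut p)⁻¹ * x :=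
    commute_coe.mpr hc
  rw [hc'] at h1
  exact commute_coe.mp (h1.unique h2)

/-! ### The action of an abstract automorphism on the tree -/

variable (α : MulAut (basilica p))

/-- If the words differed, `α g` would commute with every conjugate of `α g'` by the level subgroup,
which fixes `v'`. Pulling back along `α` contradicts noncommutation below `u`. -/
theorem supportedOn_image_unique {u v v' : List (Fin p)} {g g' : basilica p}
    (hg1 : g ≠ 1) (hg1' : g' ≠ 1)
    (hgu : SupportedOn (g : TreeAut p) u) (hgu' : SupportedOn (g' : TreeAut p) u)
    (hv : v.length = u.length) (hv' : v'.length = u.length)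
    (hgv : SupportedOn (α g : TreeAut p) v) (hgv' : SupportedOn (α g' : TreeAut p) v') :
    v = v' := by
  by_contra hne
  obtain ⟨h, hh, hc⟩ := exists_powerSeries_not_commute_conj hg1 hg1' hgu hgu'
  have hfix := powerSeries_apply (map_mem_powerSeries α hh) hv'
  have h1 : Commute (α g) (α h * α g' * (α h)⁻¹) :=
    commute_coe.mp (hgv.commute (hgv'.conj' hfix) (hv.trans hv'.symm) hne)
  rw [← map_inv, ← map_mul, ← map_mul] at h1
  exact hc (α.injective (by simpa only [map_mul] using h1.eq))

/-- Each word moved by `α g` yields a nontrivial element supported on `u` whose image is supported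
on the length-`u.length` prefix of that word. Uniqueness forces all these prefixes to coincide. -/
theorem exists_supportedOn_image {u : List (Fin p)} {g : basilica p} (hg1 : g ≠ 1)
    (hg : g ∈ powerSeriesSubgroup p (basilica p) u.length)
    (hgu : SupportedOn (g : TreeAut p) u) :
    ∃ v, v.length = u.length ∧ SupportedOn (α g : TreeAut p) v := by
  have hαg := map_mem_powerSeries α hg
  have hlen : ∀ z, (α g : TreeAut p) z ≠ z → (z.take u.length).length = u.length := fun z hz => by
    have : ¬ z.length ≤ u.length := fun h => hz (powerSeries_apply_of_le hαg h)
    rw [List.length_take]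
    omega
  have key : ∀ z, (α g : TreeAut p) z ≠ z → ∃ c : basilica p, c ≠ 1 ∧
      SupportedOn (c : TreeAut p) u ∧ SupportedOn (α c : TreeAut p) (z.take u.length) := by
    intro z hz
    obtain ⟨r, hr, hr1, hrz⟩ := exists_mem_supportedOn _ (powerSeries_ne_bot u.length) z
    have hnc : ¬ Commute (α g) r := fun h =>
      hrz.not_commute (fun e => hr1 (Subtype.ext e)) hz (commute_coe.mpr h)
    obtain ⟨s, rfl⟩ := α.surjective r
    have hs : s ∈ powerSeriesSubgroup p (basilica p) u.length := by
      simpa using map_mem_powerSeries α⁻¹ hr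
    -- `s` fixes `u`, so the commutator stays supported on `u`. Its image is a commutator with `α
    -- s`, which is supported below the prefix of `z`, a word fixed by `α g`.
    refine ⟨⁅g, s⁆, fun h => hnc ?_, ?_, ?_⟩
    · rw [← commutatorElement_eq_one_iff_commute, ← map_commutatorElement, h, map_one]
    · have := hgu.mul (hgu.inv.conj' (powerSeries_apply hs rfl))
      rwa [← mul_assoc, ← mul_assoc] at this
    · have h1 := hrz.mono (List.take_prefix u.length z)
      have := (h1.conj' (powerSeries_apply hαg (hlen z hz))).mul h1.inv
      rw [map_commutatorElement]
      exact this
  obtain ⟨z, hz⟩ := exists_coe_apply_ne (fun h => hg1 ((map_eq_one_iff α α.injective).mp h))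
  refine ⟨z.take u.length, hlen z hz, fun w hw => ?_⟩
  by_contra hne
  obtain ⟨c, hc1, hcu, hcz⟩ := key z hz
  obtain ⟨d, hd1, hdu, hdw⟩ := key w hne
  have := supportedOn_image_unique α hc1 hd1 hcu hdu (hlen z hz) (hlen w hne) hcz hdw
  exact hw (this ▸ List.take_prefix _ _)

theorem exists_wordMap (u : List (Fin p)) : ∃ v, v.length = u.length ∧
    ∀ g ∈ powerSeriesSubgroup p (basilica p) u.length, SupportedOn (g : TreeAut p) u →
      SupportedOn (α g : TreeAut p) v := by
  obtain ⟨g, hg, hg1, hgu⟩ := exists_mem_supportedOn _ (powerSeries_ne_bot (p := p) u.length) u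
  obtain ⟨v, hv, hgv⟩ := exists_supportedOn_image α hg1 hg hgu
  refine ⟨v, hv, fun g' hg' hgu' => ?_⟩
  by_cases hg1' : g' = 1
  · rw [hg1', map_one]
    exact fun w _ => rfl
  · obtain ⟨v', hv', hgv'⟩ := exists_supportedOn_image α hg1' hg' hgu'
    rwa [supportedOn_image_unique α hg1 hg1' hgu hgu' hv hv' hgv hgv']

/-- The map on words that an automorphism of the group induces through its action on rigid
stabilisers. -/
noncomputable def wordMap (u : List (Fin p)) : List (Fin p) := (exists_wordMap α u).choose

@[simp] theorem wordMap_length (u : List (Fin p)) : (wordMap α u).length = u.length :=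
  (exists_wordMap α u).choose_spec.1

theorem supportedOn_wordMap {u : List (Fin p)} {g : basilica p}
    (hg : g ∈ powerSeriesSubgroup p (basilica p) u.length) (hgu : SupportedOn (g : TreeAut p) u) :
    SupportedOn (α g : TreeAut p) (wordMap α u) :=
  (exists_wordMap α u).choose_spec.2 g hg hgu

/-- A single nontrivial witness determines the image word; inverses and equivariance follow by
choosing one. -/
theorem eq_wordMap {u v : List (Fin p)} {g : basilica p}
    (hg : g ∈ powerSeriesSubgroup p (basilica p) u.length) (hg1 : g ≠ 1)
    (hgu : SupportedOn (g : TreeAut p) u) (hv : v.length = u.length)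
    (hgv : SupportedOn (α g : TreeAut p) v) : v = wordMap α u :=
  supportedOn_image_unique α hg1 hg1 hgu hgu hv (wordMap_length α u) hgv
    (supportedOn_wordMap α hg hgu)

theorem wordMap_inv_wordMap (u : List (Fin p)) : wordMap α⁻¹ (wordMap α u) = u := by
  obtain ⟨g, hg, hg1, hgu⟩ := exists_mem_supportedOn _ (powerSeries_ne_bot (p := p) u.length) u
  have hu := wordMap_length α u
  refine (eq_wordMap α⁻¹ (g := α g) ?_ ?_ (supportedOn_wordMap α hg hgu) hu.symm ?_).symm
  · rw [hu]
    exact map_mem_powerSeries α hg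
  · exact fun h => hg1 ((map_eq_one_iff α α.injective).mp h)
  · rwa [MulAut.inv_apply_self]

theorem wordMap_append_singleton (u : List (Fin p)) (x : Fin p) :
    ∃ y, wordMap α (u ++ [x]) = wordMap α u ++ [y] := by
  obtain ⟨g, hg, hg1, hgx⟩ :=
    exists_mem_supportedOn _ (powerSeries_ne_bot (p := p) (u ++ [x]).length) (u ++ [x])
  have hg' : g ∈ powerSeriesSubgroup p (basilica p) u.length := by
    rw [List.length_append] at hg
    exact powerSeries_succ_le hg
  have h1 := supportedOn_wordMap α hg hgx
  have h2 := supportedOn_wordMap α hg' (hgx.mono (List.prefix_append _ _))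
  -- A word moved by `α g` extends both image words, so these are comparable.
  obtain ⟨z, hz⟩ := exists_coe_apply_ne (fun h => hg1 ((map_eq_one_iff α α.injective).mp h))
  obtain ⟨t, ht⟩ := List.prefix_of_prefix_length_le (h2.prefix_of_ne hz) (h1.prefix_of_ne hz)
    (by simp)
  have hl := congrArg List.length ht
  simp only [List.length_append, wordMap_length, List.length_singleton] at hl
  obtain ⟨y, rfl⟩ := List.length_eq_one_iff.mp (Nat.add_left_cancel hl)
  exact ⟨y, ht.symm⟩

/-- The automorphism of the tree that induces the given automorphism of the group. -/
noncomputable def inducedTreeAut : TreeAut p where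
  toFun := wordMap α
  invFun := wordMap α⁻¹
  left_inv := wordMap_inv_wordMap α
  right_inv u := by simpa using wordMap_inv_wordMap α⁻¹ u
  map_rel_iff' := by
    intro u v
    refine ⟨fun h => ?_, fun h => adj_of_append (wordMap_append_singleton α) h⟩
    have h' := adj_of_append (wordMap_append_singleton α⁻¹) h
    simpa [wordMap_inv_wordMap] using h'

theorem wordMap_apply (k : basilica p) (u : List (Fin p)) :
    wordMap α ((k : TreeAut p) u) = (α k : TreeAut p) (wordMap α u) := by
  obtain ⟨g, hg, hg1, hgu⟩ := exists_mem_supportedOn _ (powerSeries_ne_bot (p := p) u.length) u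
  refine (eq_wordMap α (g := k * g * k⁻¹) ?_ ?_ (hgu.conj k) (by simp) ?_).symm
  · rw [treeAut_length]
    exact powerSeries_normal.conj_mem g hg k
  · exact fun h => hg1 (conj_eq_one_iff.mp h)
  · rw [map_mul, map_mul, map_inv]
    exact (supportedOn_wordMap α hg hgu).conj (α k)

theorem inducedTreeAut_conj (k : basilica p) :
    inducedTreeAut α * (k : TreeAut p) * (inducedTreeAut α)⁻¹ = (α k : TreeAut p) := by
  rw [mul_inv_eq_iff_eq_mul]
  exact RelIso.ext (wordMap_apply α k)

theorem inducedTreeAut_mem_normalizer :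
    inducedTreeAut α ∈ Subgroup.normalizer (basilica p : Set (TreeAut p)) := by
  rw [Subgroup.mem_normalizer_iff]
  intro h
  refine ⟨fun hh => ?_, fun hh => ?_⟩
  · rw [inducedTreeAut_conj α ⟨h, hh⟩]
    exact (α ⟨h, hh⟩).2
  · obtain ⟨k, hk⟩ := α.surjective ⟨_, hh⟩
    have := inducedTreeAut_conj α k
    rw [hk] at this
    have e := mul_left_cancel (mul_right_cancel this)
    exact e ▸ k.2

/-- The centraliser of the group in the automorphism group of the tree is trivial. -/
theorem eq_one_of_commute {f : TreeAut p} (h : ∀ g ∈ basilica p, Commute f g) : f = 1 := by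
  by_contra hf
  obtain ⟨v, hv⟩ := exists_apply_ne hf
  obtain ⟨g, -, hg1, hg⟩ := exists_supportedOn v
  exact hg.not_commute (fun e => hg1 (Subtype.ext e)) hv (h g g.2)

end PBasilica

-- Bijectivity of the conjugation map

theorem mainTheorem6 (p : ℕ) (hp : p.Prime) :
    Function.Bijective
      (Subgroup.normalizerMonoidHom (PBasilica.basilica p) :
        Subgroup.normalizer (PBasilica.basilica p : Set (PBasilica.TreeAut p)) →*
          MulAut (PBasilica.basilica p)) := by
  have : Fact p.Prime := ⟨hp⟩
  constructor
  · rw [injective_iff_map_eq_one]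
    intro f hf
    refine Subtype.ext (PBasilica.eq_one_of_commute fun g hg => ?_)
    have h := congrArg Subtype.val (DFunLike.congr_fun hf ⟨g, hg⟩)
    exact mul_inv_eq_iff_eq_mul.mp h
  · intro α
    refine ⟨⟨_, PBasilica.inducedTreeAut_mem_normalizer α⟩, MulEquiv.ext fun k => ?_⟩
    exact Subtype.ext (PBasilica.inducedTreeAut_conj α k)
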